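/- \textbf{Setting.} Let $A,C\in\mathbb R^{n\times n}$, $B,D\in\mathbb R^{n\times m}$, and let $(w_k)_{k\ge 0}$ be independent real random variables on a probability space with $\mathbb E\,w_k=0$ and $\mathbb E(w_kw_s)=\delta_{ks}$. For matrices $\mathsf A,\mathsf C\in\mathbb R^{n\times n}$, the system $[\mathsf A;\mathsf C]$ is $x_{k+1}=\mathsf A x_k+\mathsf C x_k w_k$ with deterministic $x_0\in\mathbb R^n$; it is called asymptotically mean square stable if $\mathbb E\|x_k\|^2\to 0$ for every $x_0$. Assume: (1) $Q\in\mathbb R^{n\times n}$ is symmetric positive semidefinite and $R\in\mathbb R^{m\times m}$ is symmetric positive definite; (2) the controlled system $x_{k+1}=Ax_k+Bu_k+(Cx_k+Du_k)w_k$ is stabilizable, i.e. $[A+BF;C+DF]$ is asymptotically mean square stable for some $F\in\mathbb R^{m\times n}$; (3) $(A,C|Q)$ is exactly observable or exactly detectable, i.e. there is an integer $T\ge 1$ such that every solution of $x_{k+1}=Ax_k+Cx_kw_k$ with $Qx_k=0$ almost surely for $k=0,\dots,T$ satisfies $x_0=0$ (exact observability), respectively $\mathbb E\|x_k\|^2\to0$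 (exact detectability). Let $z_1,\dots,z_r\in\mathbb R^n$ and freely chosen initial controls $u_0^1,\dots,u_0^r\in\mathbb R^m$ be such that, with $v_0^l=\begin{bmatrix}z_l\\u_0^l\end{bmatrix}$, $$\Xi:=\sum_{l=1}^r v_0^l(v_0^l)'\succ0 .$$ Put $\Lambda=\begin{bmatrix}Q&0\\0&R\end{bmatrix}$ and, for $F\in\mathbb R^{m\times n}$, $A_F=\begin{bmatrix}A&B\\FA&FB\end{bmatrix}$ and $C_F=\begin{bmatrix}C&D\\FC&FD\end{bmatrix}$. The modified primal problem $(\hat{\mathcal P}_1\text{-SLQR})$ has optimal value $$\hat J_{\mathcal P_1}=\inf\Big\{\mathrm{Tr}(\Lambda\widetilde S)\;:\;\widetilde S=\widetilde S'\in\mathbb R^{(n+m)\times(n+m)},\ F\in\mathbb R^{m\times n},\ A_F\widetilde SA_F'+C_F\widetilde SC_F'+\Xi=\widetilde S,\ \widetilde S\succ0\Big\}.$$ Its Lagrangian is $$\hat L(X,F,\widetilde S,X_0)=\mathrm{Tr}(X\Xi)+\mathrm{Tr}\big[(A_F'XA_F+C_F'XC_F-X-X_0+\Lambda)\widetilde S\big],$$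 and its dual problem has optimal value $$\hat J_{\mathcal D}=\sup_{X=X',\;X_0\succeq0}\ \inf_{\widetilde S\succ0,\;F\in\mathbb R^{m\times n}}\hat L(X,F,\widetilde S,X_0),$$ where $X,X_0,\widetilde S$ range over real symmetric $(n+m)\times(n+m)$ matrices and all infima and suprema are taken in $[-\infty,+\infty]$. \textbf{Theorem (strong duality for the modified problem).} Under these assumptions $\hat J_{\mathcal P_1}=\hat J_{\mathcal D}$. -/

import Mathlib

open Matrix MeasureTheory ProbabilityTheory Filter Topology

namespace SLQR

noncomputable section

/-- The driving noise: a sequence of independent real random variables with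
`E w_k = 0` and `E (w_k w_s) = δ_{ks}`. -/
structure IsNoise {Ω : Type*} [MeasurableSpace Ω] (P : Measure Ω) (w : ℕ → Ω → ℝ) : Prop where
  measurable : ∀ k, Measurable (w k)
  indep : iIndepFun w P
  mean_zero : ∀ k, ∫ ω, w k ω ∂P = 0
  covariance : ∀ k s, ∫ ω, w k ω * w s ω ∂P = if k = s then 1 else 0

/-- The solution of `x_{k+1} = A x_k + (C x_k) w_k`, `x_0 = z`. -/
def state {Ω : Type*} {n : ℕ} (A C : Matrix (Fin n) (Fin n) ℝ) (w : ℕ → Ω → ℝ)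
    (z : Fin n → ℝ) : ℕ → Ω → (Fin n → ℝ)
  | 0 => fun _ => z
  | k + 1 => fun ω => A *ᵥ state A C w z k ω + w k ω • (C *ᵥ state A C w z k ω)

/-- The mean square `E (x_k' x_k)` tends to zero along the solution started at `z`. -/
def MeanSquareTendsToZero {Ω : Type*} [MeasurableSpace Ω] (P : Measure Ω) (w : ℕ → Ω → ℝ) {n : ℕ}
    (A C : Matrix (Fin n) (Fin n) ℝ) (z : Fin n → ℝ) : Prop :=
  Tendsto (fun k => ∫ ω, state A C w z k ω ⬝ᵥ state A C w z k ω ∂P) atTop (𝓝 0)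

/-- `[A; C]` is asymptotically mean square stable. -/
def ASMS {Ω : Type*} [MeasurableSpace Ω] (P : Measure Ω) (w : ℕ → Ω → ℝ) {n : ℕ}
    (A C : Matrix (Fin n) (Fin n) ℝ) : Prop :=
  ∀ z : Fin n → ℝ, MeanSquareTendsToZero P w A C z

/-- `[A, B; C, D]` is stabilizable by a constant state feedback `u_k = F x_k`. -/
def Stabilizable {Ω : Type*} [MeasurableSpace Ω] (P : Measure Ω) (w : ℕ → Ω → ℝ) {n m : ℕ}
    (A : Matrix (Fin n) (Fin n) ℝ) (B : Matrix (Fin n) (Fin m) ℝ)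
    (C : Matrix (Fin n) (Fin n) ℝ) (D : Matrix (Fin n) (Fin m) ℝ) : Prop :=
  ∃ F : Matrix (Fin m) (Fin n) ℝ, ASMS P w (A + B * F) (C + D * F)

/-- The output `y_k = Q x_k` vanishes almost surely for `k = 0, …, T`. -/
def OutputVanishes {Ω : Type*} [MeasurableSpace Ω] (P : Measure Ω) (w : ℕ → Ω → ℝ) {n : ℕ}
    (A C Q : Matrix (Fin n) (Fin n) ℝ) (T : ℕ) (z : Fin n → ℝ) : Prop :=
  ∀ k ≤ T, ∀ᵐ ω ∂P, Q *ᵥ state A C w z k ω = 0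

/-- `(A, C | Q)` is exactly observable. -/
def ExactlyObservable {Ω : Type*} [MeasurableSpace Ω] (P : Measure Ω) (w : ℕ → Ω → ℝ) {n : ℕ}
    (A C Q : Matrix (Fin n) (Fin n) ℝ) : Prop :=
  ∃ T : ℕ, 0 < T ∧ ∀ z : Fin n → ℝ, OutputVanishes P w A C Q T z → z = 0

/-- `(A, C | Q)` is exactly detectable. -/
def ExactlyDetectable {Ω : Type*} [MeasurableSpace Ω] (P : Measure Ω) (w : ℕ → Ω → ℝ) {n : ℕ}
    (A C Q : Matrix (Fin n) (Fin n) ℝ) : Prop :=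
  ∃ T : ℕ, 0 < T ∧ ∀ z : Fin n → ℝ,
    OutputVanishes P w A C Q T z → MeanSquareTendsToZero P w A C z

/-- The augmented matrix `[[A, B], [F A, F B]]`. With `(C, D)` in place of `(A, B)` it is `C_F`. -/
def augmented {n m : ℕ} (A : Matrix (Fin n) (Fin n) ℝ) (B : Matrix (Fin n) (Fin m) ℝ)
    (F : Matrix (Fin m) (Fin n) ℝ) : Matrix (Fin n ⊕ Fin m) (Fin n ⊕ Fin m) ℝ :=
  fromBlocks A B (F * A) (F * B)

/-- The block diagonal weight `Λ = diag(Q, R)`. -/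
def weight {n m : ℕ} (Q : Matrix (Fin n) (Fin n) ℝ) (R : Matrix (Fin m) (Fin m) ℝ) :
    Matrix (Fin n ⊕ Fin m) (Fin n ⊕ Fin m) ℝ :=
  fromBlocks Q 0 0 R

/-- `Ξ = ∑_l v_0^l (v_0^l)'`, where `v_0^l` stacks the initial state `z_l` and the freely chosen
initial control `u_0^l`. -/
def initialGram {n m r : ℕ} (z : Fin r → Fin n → ℝ) (u₀ : Fin r → Fin m → ℝ) :
    Matrix (Fin n ⊕ Fin m) (Fin n ⊕ Fin m) ℝ :=
  ∑ l, vecMulVec (Sum.elim (z l) (u₀ l)) (Sum.elim (z l) (u₀ l))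

/-- Feasibility of `(S, F)` in the modified primal problem. -/
def PrimalFeasible {n m : ℕ}
    (A : Matrix (Fin n) (Fin n) ℝ) (B : Matrix (Fin n) (Fin m) ℝ)
    (C : Matrix (Fin n) (Fin n) ℝ) (D : Matrix (Fin n) (Fin m) ℝ)
    (Ξ S : Matrix (Fin n ⊕ Fin m) (Fin n ⊕ Fin m) ℝ) (F : Matrix (Fin m) (Fin n) ℝ) : Prop :=
  augmented A B F * S * (augmented A B F)ᵀ + augmented C D F * S * (augmented C D F)ᵀ + Ξ = S ∧
    S.PosDef

/-- The optimal value of the modified primal problem: the infimum of `Tr (Λ S)` over all feasible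
pairs, as an extended real. -/
def primalValue {n m : ℕ}
    (A : Matrix (Fin n) (Fin n) ℝ) (B : Matrix (Fin n) (Fin m) ℝ)
    (C : Matrix (Fin n) (Fin n) ℝ) (D : Matrix (Fin n) (Fin m) ℝ)
    (Λ Ξ : Matrix (Fin n ⊕ Fin m) (Fin n ⊕ Fin m) ℝ) : EReal :=
  ⨅ (S : Matrix (Fin n ⊕ Fin m) (Fin n ⊕ Fin m) ℝ) (F : Matrix (Fin m) (Fin n) ℝ)
    (_ : PrimalFeasible A B C D Ξ S F), ((trace (Λ * S) : ℝ) : EReal)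

/-- The Lagrangian
`L(X, F, S, X₀) = Tr (X Ξ) + Tr ((A_F' X A_F + C_F' X C_F - X - X₀ + Λ) S)`. -/
def lagrangian {n m : ℕ}
    (A : Matrix (Fin n) (Fin n) ℝ) (B : Matrix (Fin n) (Fin m) ℝ)
    (C : Matrix (Fin n) (Fin n) ℝ) (D : Matrix (Fin n) (Fin m) ℝ)
    (Λ Ξ X : Matrix (Fin n ⊕ Fin m) (Fin n ⊕ Fin m) ℝ) (F : Matrix (Fin m) (Fin n) ℝ)
    (S X₀ : Matrix (Fin n ⊕ Fin m) (Fin n ⊕ Fin m) ℝ) : ℝ :=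
  trace (X * Ξ) +
    trace (((augmented A B F)ᵀ * X * augmented A B F + (augmented C D F)ᵀ * X * augmented C D F
      - X - X₀ + Λ) * S)

/-- The optimal value of the Lagrangian dual problem: the supremum over symmetric `X` and `X₀ ⪰ 0`
of the infimum over `S ≻ 0` and all gains `F` of the Lagrangian, as an extended real. -/
def dualValue {n m : ℕ}
    (A : Matrix (Fin n) (Fin n) ℝ) (B : Matrix (Fin n) (Fin m) ℝ)
    (C : Matrix (Fin n) (Fin n) ℝ) (D : Matrix (Fin n) (Fin m) ℝ)
    (Λ Ξ : Matrix (Fin n ⊕ Fin m) (Fin n ⊕ Fin m) ℝ) : EReal :=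
  ⨆ (X : Matrix (Fin n ⊕ Fin m) (Fin n ⊕ Fin m) ℝ)
    (X₀ : Matrix (Fin n ⊕ Fin m) (Fin n ⊕ Fin m) ℝ) (_ : X.IsSymm) (_ : X₀.PosSemidef),
    ⨅ (S : Matrix (Fin n ⊕ Fin m) (Fin n ⊕ Fin m) ℝ) (F : Matrix (Fin m) (Fin n) ℝ)
      (_ : S.PosDef), ((lagrangian A B C D Λ Ξ X F S X₀ : ℝ) : EReal)

end

end SLQR

/-! Weak duality is the trace identity `trace_lyap_mul`: on a primal feasible pair the Lagrangian
equals Tr(ΛS) − Tr(X₀S). For the converse, perturb the weight to Λ + ε. A stabilizing gain yields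
one supersolution `Y` that serves all ε ≤ 1 (`exists_supersolution`), and below it the Riccati
equation has a solution X_ε (`exists_riccati_solution`). Its minimizing gain admits a primal
feasible S with Tr(ΛS) ≤ Tr(X_ε Ξ) (`primalValue_le_trace`). A limit point Z of X_ε satisfies the
Riccati inequality with weight Λ for every gain, so the dual value is at least Tr(ZΞ)
(`trace_le_dualValue`), while the primal value is at most lim Tr(X_ε Ξ) = Tr(ZΞ). Both matrix
equations are solved by maximizing the trace over a compact set of subsolutions
(`exists_fixed_of_isCompact`). -/

namespace SLQR

open scoped MatrixOrder

/-! ### Loewner order, trace bounds and compactness. -/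

section LoewnerOrder

variable {ι κ : Type*} [Fintype ι] [Fintype κ]

theorem exists_eq_transpose_mul_self {X : Matrix ι ι ℝ} (hX : 0 ≤ X) :
    ∃ L : Matrix ι ι ℝ, X = Lᵀ * L := by
  classical
  obtain ⟨L, hL⟩ := CStarAlgebra.nonneg_iff_eq_star_mul_self.1 hX
  exact ⟨L, by rwa [star_eq_conjTranspose, conjTranspose_eq_transpose_of_trivial] at hL⟩

theorem transpose_mul_mul_same_mono {X Y : Matrix ι ι ℝ} (h : X ≤ Y) (J : Matrix ι κ ℝ) :
    Jᵀ * X * J ≤ Jᵀ * Y * J := by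
  rw [le_iff] at h ⊢
  have := h.conjTranspose_mul_mul_same J
  rwa [conjTranspose_eq_transpose_of_trivial, Matrix.mul_sub, Matrix.sub_mul] at this

theorem trace_mono {X Y : Matrix ι ι ℝ} (h : X ≤ Y) : trace X ≤ trace Y := by
  have := (le_iff.1 h).trace_nonneg
  rw [trace_sub] at this
  linarith

theorem trace_mul_nonneg {X Y : Matrix ι ι ℝ} (hX : 0 ≤ X) (hY : 0 ≤ Y) : 0 ≤ trace (X * Y) := by
  obtain ⟨L, rfl⟩ := exists_eq_transpose_mul_self hY
  rw [← Matrix.mul_assoc, trace_mul_comm, ← Matrix.mul_assoc]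
  have := trace_mono (transpose_mul_mul_same_mono hX Lᵀ)
  simpa using this

theorem trace_mul_mono_left {X Y S : Matrix ι ι ℝ} (h : X ≤ Y) (hS : 0 ≤ S) :
    trace (X * S) ≤ trace (Y * S) := by
  have := trace_mul_nonneg (sub_nonneg.2 h) hS
  rw [Matrix.sub_mul, trace_sub] at this
  linarith

theorem trace_mul_mono_right {X Y S : Matrix ι ι ℝ} (h : X ≤ Y) (hS : 0 ≤ S) :
    trace (S * X) ≤ trace (S * Y) := by
  rw [trace_mul_comm S, trace_mul_comm S]
  exact trace_mul_mono_left h hS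

omit [Fintype ι] in
theorem smul_one_mono [DecidableEq ι] {a b : ℝ} (h : a ≤ b) :
    a • (1 : Matrix ι ι ℝ) ≤ b • (1 : Matrix ι ι ℝ) := by
  rw [le_iff, ← sub_smul]
  exact PosSemidef.one.smul (sub_nonneg.2 h)

/-- Writing X = L'L, this is Cauchy–Schwarz applied to each row of L. -/
theorem le_trace_smul_one [DecidableEq ι] {X : Matrix ι ι ℝ} (hX : 0 ≤ X) :
    X ≤ trace X • (1 : Matrix ι ι ℝ) := by
  have hH : X.IsHermitian := (nonneg_iff_posSemidef.1 hX).isHermitian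
  obtain ⟨L, rfl⟩ := exists_eq_transpose_mul_self hX
  refine PosSemidef.of_dotProduct_mulVec_nonneg
    ((isHermitian_one.smul (IsSelfAdjoint.all _)).sub hH) fun x => ?_
  have h1 : x ⬝ᵥ ((Lᵀ * L) *ᵥ x) = ∑ i, (∑ j, L i j * x j) ^ 2 := by
    rw [← mulVec_mulVec, dotProduct_mulVec, vecMul_transpose]
    simp [dotProduct, mulVec, sq]
  have h2 : trace (Lᵀ * L) = ∑ i, ∑ j, L i j ^ 2 := by
    rw [Finset.sum_comm]
    simp [trace, mul_apply, sq]
  have h3 : x ⬝ᵥ x = ∑ j, x j ^ 2 := by simp [dotProduct, sq]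
  rw [star_trivial, sub_mulVec, dotProduct_sub, smul_mulVec, one_mulVec, dotProduct_smul, h1, h2,
    h3, smul_eq_mul, Finset.sum_mul, sub_nonneg]
  exact Finset.sum_le_sum fun i _ => Finset.sum_mul_sq_le_sq_mul_sq _ _ _

theorem abs_apply_le_trace {X : Matrix ι ι ℝ} (hX : 0 ≤ X) (i j : ι) : |X i j| ≤ trace X := by
  have hd : ∀ i, X i i ≤ trace X := fun i =>
    Finset.single_le_sum (f := fun i => X i i)
      (fun k _ => (nonneg_iff_posSemidef.1 hX).diag_nonneg) (Finset.mem_univ i)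
  refine le_trans ?_ (show (X i i + X j j) / 2 ≤ trace X by linarith [hd i, hd j])
  obtain ⟨L, rfl⟩ := exists_eq_transpose_mul_self hX
  simp only [mul_apply, transpose_apply]
  rw [← Finset.sum_add_distrib, Finset.sum_div]
  refine (Finset.abs_sum_le_sum_abs _ _).trans (Finset.sum_le_sum fun k _ => ?_)
  rw [abs_le]
  constructor <;> nlinarith [sq_nonneg (L k i - L k j), sq_nonneg (L k i + L k j)]

theorem isClosed_setOf_nonneg : IsClosed {X : Matrix ι ι ℝ | 0 ≤ X} := by
  have : {X : Matrix ι ι ℝ | 0 ≤ X} =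
      {X | Xᵀ = X} ∩ ⋂ x : ι → ℝ, {X | 0 ≤ x ⬝ᵥ X *ᵥ x} := by
    ext X
    simp [nonneg_iff_posSemidef, posSemidef_iff_dotProduct_mulVec, IsHermitian,
      conjTranspose_eq_transpose_of_trivial]
  rw [this]
  refine (isClosed_eq (by fun_prop) (by fun_prop)).inter (isClosed_iInter fun x => ?_)
  exact isClosed_le continuous_const (by fun_prop)

omit [Fintype κ] in
theorem isClosed_setOf_le {f g : Matrix κ κ ℝ → Matrix ι ι ℝ} (hf : Continuous f)
    (hg : Continuous g) : IsClosed {X | f X ≤ g X} := by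
  simp_rw [← sub_nonneg (a := g _)]
  exact isClosed_setOf_nonneg.preimage (hg.sub hf)

theorem isCompact_of_trace_le {K : Set (Matrix ι ι ℝ)} (hK : IsClosed K) {c : ℝ}
    (h0 : ∀ X ∈ K, 0 ≤ X) (hc : ∀ X ∈ K, trace X ≤ c) : IsCompact K := by
  refine IsCompact.of_isClosed_subset
    (isCompact_univ_pi fun _ : ι => isCompact_univ_pi fun _ : ι => isCompact_Icc (a := -c) (b := c))
    hK fun X hX i _ j _ => ?_
  exact abs_le.1 ((abs_apply_le_trace (h0 X hX) i j).trans (hc X hX))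

/-- At a maximizer X of the trace, the larger element Y has no larger trace, so Y − X is positive
semidefinite of trace zero, hence zero. -/
theorem exists_fixed_of_isCompact {p : Matrix ι ι ℝ → Matrix ι ι ℝ → Prop}
    {K : Set (Matrix ι ι ℝ)} (hK : IsCompact K) (hne : K.Nonempty)
    (hT : ∀ X ∈ K, ∃ Y ∈ K, X ≤ Y ∧ p X Y) : ∃ X ∈ K, p X X := by
  obtain ⟨X, hX, hmax⟩ := hK.exists_isMaxOn hne (continuous_id.matrix_trace).continuousOn
  obtain ⟨Y, hY, hle, hp⟩ := hT X hX
  have h : trace Y ≤ trace X := hmax hY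
  have h0 : Y - X = 0 := (le_iff.1 hle).trace_eq_zero_iff.1
    (le_antisymm (by rw [trace_sub]; linarith) (le_iff.1 hle).trace_nonneg)
  rw [sub_eq_zero] at h0
  exact ⟨X, hX, h0 ▸ hp⟩

end LoewnerOrder

/-! ### Lyapunov operators and their trace adjoints. -/

section Lyapunov

variable {ι κ : Type*} [Fintype ι] [Fintype κ]

/-- The Lyapunov operator `X ↦ A' X A + C' X C`. -/
def lyap (A C : Matrix ι κ ℝ) : Matrix ι ι ℝ →ₗ[ℝ] Matrix κ κ ℝ where
  toFun X := Aᵀ * X * A + Cᵀ * X * C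
  map_add' X Y := by simp only [Matrix.mul_add, Matrix.add_mul]; abel
  map_smul' a X := by simp [Matrix.mul_smul, Matrix.smul_mul, smul_add]

omit [Fintype κ] in
theorem lyap_apply (A C : Matrix ι κ ℝ) (X : Matrix ι ι ℝ) :
    lyap A C X = Aᵀ * X * A + Cᵀ * X * C := rfl

theorem lyap_mono (A C : Matrix ι κ ℝ) {X Y : Matrix ι ι ℝ} (h : X ≤ Y) :
    lyap A C X ≤ lyap A C Y :=
  add_le_add (transpose_mul_mul_same_mono h A) (transpose_mul_mul_same_mono h C)

theorem lyap_nonneg (A C : Matrix ι κ ℝ) {X : Matrix ι ι ℝ} (h : 0 ≤ X) : 0 ≤ lyap A C X := by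
  simpa using lyap_mono A C h

omit [Fintype κ] in
theorem continuous_lyap (A C : Matrix ι κ ℝ) : Continuous (lyap A C) := by
  show Continuous fun X : Matrix ι ι ℝ => Aᵀ * X * A + Cᵀ * X * C
  fun_prop

theorem trace_lyap_mul (A C : Matrix ι ι ℝ) (X S : Matrix ι ι ℝ) :
    trace (lyap A C X * S) = trace (X * lyap Aᵀ Cᵀ S) := by
  simp only [lyap_apply, Matrix.add_mul, Matrix.mul_add, trace_add, transpose_transpose]
  congr 1 <;>
  · rw [Matrix.mul_assoc, Matrix.mul_assoc, trace_mul_comm]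
    simp only [Matrix.mul_assoc]

/-- The supersolution X bounds the cost of every subsolution S ≥ 0 of the adjoint equation, and W ≥
ε turns this into a trace bound. The subsolutions above Ξ thus form a compact set, preserved by S ↦
`lyap Aᵀ Cᵀ S + Ξ`. -/
theorem exists_lyapunov_equation [DecidableEq ι] {A C X W Ξ : Matrix ι ι ℝ} {ε : ℝ} (hε : 0 < ε)
    (hX : 0 ≤ X) (hW : ε • 1 ≤ W) (h : lyap A C X + W ≤ X) (hΞ : 0 ≤ Ξ) :
    ∃ S, Ξ ≤ S ∧ lyap Aᵀ Cᵀ S + Ξ = S ∧ trace (W * S) ≤ trace (X * Ξ) := by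
  -- Pair `h` with S and `hS` with X; the Lyapunov terms cancel by adjointness.
  have hcost : ∀ S, 0 ≤ S → S ≤ lyap Aᵀ Cᵀ S + Ξ → trace (W * S) ≤ trace (X * Ξ) := by
    intro S h0 hS
    have h1 := trace_mul_mono_left h h0
    have h2 := trace_mul_mono_right hS hX
    rw [Matrix.add_mul, trace_add, trace_lyap_mul] at h1
    rw [Matrix.mul_add, trace_add] at h2
    linarith
  let K : Set (Matrix ι ι ℝ) := {S | Ξ ≤ S} ∩ {S | S ≤ lyap Aᵀ Cᵀ S + Ξ}
  have hK : IsClosed K := (isClosed_setOf_le continuous_const continuous_id).inter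
    (isClosed_setOf_le continuous_id ((continuous_lyap _ _).add continuous_const))
  have hKc : IsCompact K := by
    refine isCompact_of_trace_le (c := trace (X * Ξ) / ε) hK (fun S hS => hΞ.trans hS.1)
      fun S hS => ?_
    have h0 : 0 ≤ S := hΞ.trans hS.1
    have h1 := trace_mul_mono_left hW h0
    rw [Matrix.smul_mul, Matrix.one_mul, trace_smul, smul_eq_mul] at h1
    rw [le_div_iff₀ hε, mul_comm]
    exact h1.trans (hcost S h0 hS.2)
  obtain ⟨S, hS, hfix⟩ := exists_fixed_of_isCompact (p := fun S S' => lyap Aᵀ Cᵀ S + Ξ = S') hKc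
    ⟨Ξ, le_refl Ξ, le_add_of_nonneg_left (lyap_nonneg _ _ hΞ)⟩ fun S hS =>
      ⟨lyap Aᵀ Cᵀ S + Ξ, ⟨le_add_of_nonneg_left (lyap_nonneg _ _ (hΞ.trans hS.1)),
        add_le_add_left (lyap_mono _ _ hS.2) Ξ⟩, hS.2, rfl⟩
  exact ⟨S, hS.1, hfix, hcost S (hΞ.trans hS.1) hS.2⟩

theorem iterate_lyap_one_nonneg [DecidableEq ι] (A C : Matrix ι ι ℝ) (k : ℕ) :
    0 ≤ (lyap A C)^[k] 1 := by
  induction k with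
  | zero => exact nonneg_iff_posSemidef.2 PosSemidef.one
  | succ k ih => rw [Function.iterate_succ_apply']; exact lyap_nonneg _ _ ih

/-- If some iterate of a Lyapunov operator sends the identity below one half of it, then the
operator admits a strict supersolution for every right-hand side. -/
theorem exists_lyap_add_le [DecidableEq ι] {A C : Matrix ι ι ℝ} {N : ℕ}
    (hN : (lyap A C)^[N] 1 ≤ (1 / 2 : ℝ) • 1) {W : Matrix ι ι ℝ} (hW : 0 ≤ W) :
    ∃ Y, 0 ≤ Y ∧ lyap A C Y + W ≤ Y := by
  set c := trace W
  have hc : 0 ≤ c := (nonneg_iff_posSemidef.1 hW).trace_nonneg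
  -- A truncated Neumann series: the operator sends Z to Z − 1 plus the N-th iterate, hence below Z
  -- − 1/2. Scaling by 2c makes the gap at least c, which dominates W.
  set Z := ∑ k ∈ Finset.range N, (lyap A C)^[k] 1 with hZ
  have hZ0 : 0 ≤ Z := Finset.sum_nonneg fun k _ => iterate_lyap_one_nonneg A C k
  have hLZ : lyap A C Z = Z - 1 + (lyap A C)^[N] 1 := by
    have h := Finset.sum_range_succ' (fun k => (lyap A C)^[k] (1 : Matrix ι ι ℝ)) N
    rw [Finset.sum_range_succ, ← hZ] at h
    simp only [Function.iterate_zero, id] at h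
    rw [hZ, map_sum, ← hZ, sub_add_eq_add_sub, h, add_sub_cancel_right]
    exact Finset.sum_congr rfl fun k _ => (Function.iterate_succ_apply' _ _ _).symm
  refine ⟨(2 * c) • Z,
    nonneg_iff_posSemidef.2 ((nonneg_iff_posSemidef.1 hZ0).smul (by positivity)), ?_⟩
  have h1 : (0 : Matrix ι ι ℝ) ≤ (2 * c) • ((1 / 2 : ℝ) • 1 - (lyap A C)^[N] 1) :=
    nonneg_iff_posSemidef.2 ((nonneg_iff_posSemidef.1 (sub_nonneg.2 hN)).smul (by positivity))
  have h2 := le_trace_smul_one hW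
  rw [map_smul, hLZ, ← sub_nonneg]
  have h3 := add_nonneg h1 (sub_nonneg.2 h2)
  convert h3 using 1
  module

end Lyapunov

/-! ### Gains, the augmented system and the minimizing gain. -/

section Riccati

variable {n m : ℕ}

theorem augmented_eq_mul (A : Matrix (Fin n) (Fin n) ℝ) (B : Matrix (Fin n) (Fin m) ℝ)
    (F : Matrix (Fin m) (Fin n) ℝ) :
    augmented A B F = fromRows (1 : Matrix (Fin n) (Fin n) ℝ) F * fromCols A B := by
  rw [fromRows_mul, Matrix.one_mul, mul_fromCols, fromRows_fromCols_eq_fromBlocks]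
  rfl

theorem fromCols_mul_fromRows_one (A : Matrix (Fin n) (Fin n) ℝ) (B : Matrix (Fin n) (Fin m) ℝ)
    (F : Matrix (Fin m) (Fin n) ℝ) :
    fromCols A B * fromRows (1 : Matrix (Fin n) (Fin n) ℝ) F = A + B * F := by
  rw [fromCols_mul_fromRows, Matrix.mul_one]

/-- The quadratic cost matrix `[I F'] X [I; F]` of the gain `F`. -/
def gainCost (F : Matrix (Fin m) (Fin n) ℝ) (X : Matrix (Fin n ⊕ Fin m) (Fin n ⊕ Fin m) ℝ) :
    Matrix (Fin n) (Fin n) ℝ :=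
  (fromRows (1 : Matrix (Fin n) (Fin n) ℝ) F)ᵀ * X * fromRows (1 : Matrix (Fin n) (Fin n) ℝ) F

theorem gainCost_mono (F : Matrix (Fin m) (Fin n) ℝ)
    {X Y : Matrix (Fin n ⊕ Fin m) (Fin n ⊕ Fin m) ℝ} (h : X ≤ Y) : gainCost F X ≤ gainCost F Y :=
  transpose_mul_mul_same_mono h _

theorem gainCost_add (F : Matrix (Fin m) (Fin n) ℝ)
    (X Y : Matrix (Fin n ⊕ Fin m) (Fin n ⊕ Fin m) ℝ) :
    gainCost F (X + Y) = gainCost F X + gainCost F Y := by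
  simp [gainCost, Matrix.mul_add, Matrix.add_mul]

/-- The gain enters only through `gainCost`, so minimizing the augmented operator over F reduces to
minimizing `gainCost` in the Loewner order. -/
theorem lyap_augmented (A C : Matrix (Fin n) (Fin n) ℝ) (B D : Matrix (Fin n) (Fin m) ℝ)
    (F : Matrix (Fin m) (Fin n) ℝ) (X : Matrix (Fin n ⊕ Fin m) (Fin n ⊕ Fin m) ℝ) :
    lyap (augmented A B F) (augmented C D F) X =
      lyap (fromCols A B) (fromCols C D) (gainCost F X) := by
  simp only [lyap_apply, augmented_eq_mul, gainCost, transpose_mul, Matrix.mul_assoc]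

/-- Composing the two factors in the other order gives the closed-loop operator on the state space,
where stabilizability applies. -/
theorem gainCost_lyap (A C : Matrix (Fin n) (Fin n) ℝ) (B D : Matrix (Fin n) (Fin m) ℝ)
    (F : Matrix (Fin m) (Fin n) ℝ) (P : Matrix (Fin n) (Fin n) ℝ) :
    gainCost F (lyap (fromCols A B) (fromCols C D) P) = lyap (A + B * F) (C + D * F) P := by
  simp only [lyap_apply, ← fromCols_mul_fromRows_one, gainCost, transpose_mul, Matrix.mul_assoc,
    Matrix.mul_add, Matrix.add_mul]

/-- Completing the square: if X₂₂F = −X₂₁, the cost of F' exceeds that of F by (F' − F)'X₂₂(F' − F).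
-/
theorem exists_gainCost_le {X : Matrix (Fin n ⊕ Fin m) (Fin n ⊕ Fin m) ℝ} (hX : X.PosDef) :
    ∃ F : Matrix (Fin m) (Fin n) ℝ, ∀ F', gainCost F X ≤ gainCost F' X := by
  have h22 : X.toBlocks₂₂.PosDef := hX.submatrix Sum.inr_injective
  have hXt : Xᵀ = X := hX.isHermitian
  have h12 : X.toBlocks₁₂ᵀ = X.toBlocks₂₁ := by
    ext i j; exact congrFun (congrFun hXt (Sum.inr i)) (Sum.inl j)
  have h22t : X.toBlocks₂₂ᵀ = X.toBlocks₂₂ := h22.isHermitian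
  have hu : IsUnit X.toBlocks₂₂.det := (isUnit_iff_isUnit_det _).1 h22.isUnit
  have hcost : ∀ F : Matrix (Fin m) (Fin n) ℝ, gainCost F X = X.toBlocks₁₁ + Fᵀ * X.toBlocks₂₁ +
      (X.toBlocks₁₂ * F + Fᵀ * X.toBlocks₂₂ * F) := by
    intro F
    conv_lhs => rw [gainCost, ← fromBlocks_toBlocks X, transpose_fromRows, transpose_one,
      fromCols_mul_fromBlocks, fromCols_mul_fromRows]
    simp only [Matrix.one_mul, Matrix.mul_one, Matrix.add_mul]
  obtain ⟨F, hF⟩ : ∃ F, X.toBlocks₂₂ * F = -X.toBlocks₂₁ :=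
    ⟨-(X.toBlocks₂₂⁻¹ * X.toBlocks₂₁), by
      rw [Matrix.mul_neg, ← Matrix.mul_assoc, mul_nonsing_inv _ hu, Matrix.one_mul]⟩
  have hF' : Fᵀ * X.toBlocks₂₂ = -X.toBlocks₁₂ := by
    have := congrArg transpose hF
    rwa [transpose_mul, h22t, transpose_neg, ← h12, transpose_transpose] at this
  refine ⟨F, fun F' => ?_⟩
  have h := transpose_mul_mul_same_mono h22.posSemidef.nonneg (F' - F)
  rw [Matrix.mul_zero, Matrix.zero_mul] at h
  rw [← sub_nonneg]
  convert h using 1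
  have e : Fᵀ * X.toBlocks₂₁ = X.toBlocks₁₂ * F := by
    rw [← neg_neg X.toBlocks₂₁, ← hF, Matrix.mul_neg, ← Matrix.mul_assoc, hF', Matrix.neg_mul,
      neg_neg]
  rw [hcost, hcost, hF', e, transpose_sub, Matrix.sub_mul, hF', Matrix.sub_mul, Matrix.mul_sub,
    Matrix.mul_sub, Matrix.mul_assoc _ _ F, hF]
  simp only [Matrix.neg_mul, Matrix.mul_neg]
  abel

end Riccati

end SLQR

namespace SLQR

/-! ### From mean square stability to decay of Lyapunov iterates. -/

section MeanSquare

variable {Ω : Type*} {n : ℕ}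

theorem state_congr {Ω' : Type*} (A C : Matrix (Fin n) (Fin n) ℝ) {w : ℕ → Ω → ℝ}
    {w' : ℕ → Ω' → ℝ} {ω : Ω} {ω' : Ω'} (z : Fin n → ℝ) {k : ℕ} (h : ∀ j < k, w j ω = w' j ω') :
    state A C w z k ω = state A C w' z k ω' := by
  induction k with
  | zero => rfl
  | succ k ih =>
    simp only [state, ih fun j hj => h j (hj.trans k.lt_succ_self), h k k.lt_succ_self]

variable [MeasurableSpace Ω]

theorem measurable_state (A C : Matrix (Fin n) (Fin n) ℝ) {w : ℕ → Ω → ℝ}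
    (hw : ∀ k, Measurable (w k)) (z : Fin n → ℝ) (k : ℕ) : Measurable (state A C w z k) := by
  induction k with
  | zero => exact measurable_const
  | succ k ih =>
    have hM : ∀ M : Matrix (Fin n) (Fin n) ℝ, Measurable fun ω => M *ᵥ state A C w z k ω :=
      fun M => (show Continuous fun x : Fin n → ℝ => M *ᵥ x by fun_prop).measurable.comp ih
    exact (hM A).add ((hw k).smul (hM C))

variable {P : Measure Ω} {w : ℕ → Ω → ℝ}

theorem indepFun_state (hw : IsNoise P w) (A C : Matrix (Fin n) (Fin n) ℝ) (z : Fin n → ℝ)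
    (k : ℕ) : IndepFun (state A C w z k) (w k) P := by
  have h := hw.indep.indepFun_finset (Finset.range k) {k} (by simp) hw.measurable
  -- The noise rebuilt from its first k values; the default 0 is never read, since the state at time
  -- k uses only earlier noise.
  let w' : ℕ → (Finset.range k → ℝ) → ℝ := fun j y =>
    if hj : j ∈ Finset.range k then y ⟨j, hj⟩ else 0
  have hw' : ∀ j, Measurable (w' j) := by
    intro j
    by_cases hj : j ∈ Finset.range k
    · simpa only [w', hj, dite_true] using measurable_pi_apply _
    · simpa only [w', hj, dite_false] using measurable_const
  have h' := h.comp (measurable_state A C hw' z k)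
    (measurable_pi_apply (⟨k, Finset.mem_singleton_self k⟩ : ({k} : Finset ℕ)))
  convert h' using 1
  · ext1 ω
    exact state_congr A C z fun j hj => by simp [w', hj]
  · rfl

/-- The integral of a non-integrable function is 0 by convention, whereas this one is 1. -/
theorem integrable_sq_noise (hw : IsNoise P w) (k : ℕ) : Integrable (fun ω => w k ω * w k ω) P := by
  by_contra h
  have := hw.covariance k k
  rw [integral_undef h] at this
  simp at this

theorem integrable_noise [IsProbabilityMeasure P] (hw : IsNoise P w) (k : ℕ) :
    Integrable (w k) P := by
  refine MemLp.integrable one_le_two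
    ((memLp_two_iff_integrable_sq (hw.measurable k).aestronglyMeasurable).2 ?_)
  simpa only [sq] using integrable_sq_noise hw k

/-- Since `w k` is independent of the state at time k, with mean 0 and second moment 1, the last
step replaces M by `lyap A C M`; hence the induction over all M. -/
theorem quadratic_state [IsProbabilityMeasure P] (hw : IsNoise P w)
    (A C : Matrix (Fin n) (Fin n) ℝ) (z : Fin n → ℝ) (k : ℕ) (M : Matrix (Fin n) (Fin n) ℝ) :
    Integrable (fun ω => state A C w z k ω ⬝ᵥ M *ᵥ state A C w z k ω) P ∧
      ∫ ω, state A C w z k ω ⬝ᵥ M *ᵥ state A C w z k ω ∂P =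
        z ⬝ᵥ ((lyap A C)^[k] M) *ᵥ z := by
  induction k generalizing M with
  | zero => simp [state]
  | succ k ih =>
    let q : Matrix (Fin n) (Fin n) ℝ → Ω → ℝ :=
      fun M ω => state A C w z k ω ⬝ᵥ M *ᵥ state A C w z k ω
    have hq : ∀ M, Measurable fun x : Fin n → ℝ => x ⬝ᵥ M *ᵥ x := fun M =>
      (show Continuous fun x : Fin n → ℝ => x ⬝ᵥ M *ᵥ x by fun_prop).measurable
    have hqm : ∀ M, Measurable (q M) := fun M =>
      (hq M).comp (measurable_state A C hw.measurable z k)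
    have hi1 : ∀ M, IndepFun (q M) (w k) P := fun M =>
      (indepFun_state hw A C z k).comp (hq M) measurable_id
    have hi2 : ∀ M, IndepFun (q M) (fun ω => w k ω * w k ω) P := fun M =>
      (indepFun_state hw A C z k).comp (hq M) (measurable_id.mul measurable_id)
    have hI1 : Integrable (q (Aᵀ * M * C + Cᵀ * M * A) * w k) P :=
      (hi1 _).integrable_mul (ih _).1 (integrable_noise hw k)
    have hI2 : Integrable (q (Cᵀ * M * C) * fun ω => w k ω * w k ω) P :=
      (hi2 _).integrable_mul (ih _).1 (integrable_sq_noise hw k)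
    have hI0 : Integrable (q (Aᵀ * M * A)) P := (ih _).1
    have e1 : ∫ ω, (q (Aᵀ * M * C + Cᵀ * M * A) * w k) ω ∂P = 0 := by
      rw [(hi1 _).integral_mul_eq_mul_integral (hqm _).aestronglyMeasurable
        (hw.measurable k).aestronglyMeasurable, hw.mean_zero, mul_zero]
    have e2 : ∫ ω, (q (Cᵀ * M * C) * fun ω => w k ω * w k ω) ω ∂P =
        ∫ ω, q (Cᵀ * M * C) ω ∂P := by
      rw [(hi2 _).integral_mul_eq_mul_integral (hqm _).aestronglyMeasurable
        ((hw.measurable k).mul (hw.measurable k)).aestronglyMeasurable, hw.covariance, if_pos rfl,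
        mul_one]
    have hexp : (fun ω => state A C w z (k + 1) ω ⬝ᵥ M *ᵥ state A C w z (k + 1) ω) =
        q (Aᵀ * M * A) + (q (Aᵀ * M * C + Cᵀ * M * A) * w k +
          q (Cᵀ * M * C) * fun ω => w k ω * w k ω) := by
      ext ω
      have hG : ∀ (G H : Matrix (Fin n) (Fin n) ℝ) (x : Fin n → ℝ),
          x ⬝ᵥ (Gᵀ * M * H) *ᵥ x = (G *ᵥ x) ⬝ᵥ M *ᵥ (H *ᵥ x) := by
        intro G H x
        rw [← mulVec_mulVec, ← mulVec_mulVec, dotProduct_mulVec x, vecMul_transpose]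
      simp only [state, q, Pi.add_apply, Pi.mul_apply, add_mulVec, dotProduct_add, hG, mulVec_add,
        mulVec_smul, add_dotProduct, smul_dotProduct, dotProduct_smul, smul_eq_mul]
      ring
    rw [hexp]
    refine ⟨hI0.add (hI1.add hI2), ?_⟩
    rw [integral_add' hI0 (hI1.add hI2), integral_add' hI1 hI2, e1, e2, zero_add, (ih _).2, (ih _).2,
      Function.iterate_succ_apply, lyap_apply, ← dotProduct_add, ← add_mulVec]
    congr 2
    rw [← Module.End.coe_pow, map_add]

open scoped MatrixOrder in
-- The trace of the k-th iterate is the sum of E‖x_k‖² over the basis vectors as initial states, and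
-- it dominates the iterate.
theorem exists_iterate_lyap_le [IsProbabilityMeasure P] (hw : IsNoise P w)
    {A C : Matrix (Fin n) (Fin n) ℝ} (h : ASMS P w A C) :
    ∃ N, (lyap A C)^[N] 1 ≤ (1 / 2 : ℝ) • (1 : Matrix (Fin n) (Fin n) ℝ) := by
  have ht : Tendsto (fun k => trace ((lyap A C)^[k] 1)) atTop (𝓝 0) := by
    have : Tendsto (fun k => ∑ i, Pi.single i 1 ⬝ᵥ ((lyap A C)^[k] 1) *ᵥ (Pi.single i 1)) atTop
        (𝓝 (∑ _i : Fin n, (0 : ℝ))) := by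
      refine tendsto_finsetSum _ fun i _ => ?_
      have := h (Pi.single i 1)
      refine this.congr fun k => ?_
      rw [← (quadratic_state hw A C _ k 1).2]
      simp only [one_mulVec]
    simpa [trace] using this
  obtain ⟨N, hN⟩ := (ht.eventually (gt_mem_nhds (by norm_num : (0 : ℝ) < 1 / 2))).exists
  exact ⟨N, (le_trace_smul_one (iterate_lyap_one_nonneg A C N)).trans (smul_one_mono hN.le)⟩

end MeanSquare

end SLQR

namespace SLQR

open scoped MatrixOrder

/-! ### Weak duality, the Riccati equation and the limit ε → 0. -/

section Duality

variable {n m : ℕ} {A C : Matrix (Fin n) (Fin n) ℝ} {B D : Matrix (Fin n) (Fin m) ℝ}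
  {Λ Ξ X : Matrix (Fin n ⊕ Fin m) (Fin n ⊕ Fin m) ℝ}

theorem lagrangian_eq (A C : Matrix (Fin n) (Fin n) ℝ) (B D : Matrix (Fin n) (Fin m) ℝ)
    (Λ Ξ X : Matrix (Fin n ⊕ Fin m) (Fin n ⊕ Fin m) ℝ) (F : Matrix (Fin m) (Fin n) ℝ)
    (S X₀ : Matrix (Fin n ⊕ Fin m) (Fin n ⊕ Fin m) ℝ) :
    lagrangian A B C D Λ Ξ X F S X₀ = trace (X * Ξ) +
      trace ((lyap (augmented A B F) (augmented C D F) X - X - X₀ + Λ) * S) := rfl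

theorem dualValue_le_primalValue (A C : Matrix (Fin n) (Fin n) ℝ) (B D : Matrix (Fin n) (Fin m) ℝ)
    (Λ Ξ : Matrix (Fin n ⊕ Fin m) (Fin n ⊕ Fin m) ℝ) :
    dualValue A B C D Λ Ξ ≤ primalValue A B C D Λ Ξ := by
  refine le_iInf fun S => le_iInf fun F => le_iInf fun hS => ?_
  refine iSup_le fun X => iSup_le fun X₀ => iSup_le fun _ => iSup_le fun hX₀ => ?_
  refine (iInf₂_le_of_le S F (iInf_le_of_le hS.2 le_rfl)).trans ?_
  rw [EReal.coe_le_coe_iff, lagrangian_eq]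
  have h1 := congrArg (fun M => trace (X * M)) hS.1
  have h2 := trace_lyap_mul (augmented A B F) (augmented C D F) X S
  have h3 := trace_mul_nonneg hX₀.nonneg hS.2.posSemidef.nonneg
  rw [lyap_apply _ _ S] at h2
  simp only [transpose_transpose] at h2
  simp only [Matrix.mul_add X, trace_add] at h1 h2
  simp only [Matrix.add_mul, Matrix.sub_mul, trace_add, trace_sub]
  linarith

/-- With X₀ = 0, the hypothesis makes the second trace of the Lagrangian nonnegative for all S and
F. -/
theorem trace_le_dualValue (hX : 0 ≤ X)
    (h : ∀ F, X ≤ lyap (augmented A B F) (augmented C D F) X + Λ) :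
    ((trace (X * Ξ) : ℝ) : EReal) ≤ dualValue A B C D Λ Ξ := by
  have hs : X.IsSymm := by
    have := (nonneg_iff_posSemidef.1 hX).isHermitian
    rwa [IsHermitian, conjTranspose_eq_transpose_of_trivial] at this
  refine le_iSup_of_le X <| le_iSup_of_le 0 <| le_iSup_of_le hs <| le_iSup_of_le PosSemidef.zero ?_
  refine le_iInf fun S => le_iInf fun F => le_iInf fun hS => ?_
  rw [EReal.coe_le_coe_iff, lagrangian_eq, sub_zero, sub_add_eq_add_sub]
  have := trace_mul_nonneg (sub_nonneg.2 (h F)) hS.posSemidef.nonneg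
  linarith

theorem primalValue_le_trace {W : Matrix (Fin n ⊕ Fin m) (Fin n ⊕ Fin m) ℝ}
    {F : Matrix (Fin m) (Fin n) ℝ} {ε : ℝ} (hε : 0 < ε) (hΞ : Ξ.PosDef) (hX : 0 ≤ X)
    (hW : ε • 1 ≤ W) (hΛ : Λ ≤ W)
    (h : lyap (augmented A B F) (augmented C D F) X + W = X) :
    primalValue A B C D Λ Ξ ≤ ((trace (X * Ξ) : ℝ) : EReal) := by
  obtain ⟨S, hΞS, hS, hle⟩ := exists_lyapunov_equation hε hX hW h.le hΞ.posSemidef.nonneg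
  have hS0 : S.PosDef := by
    have := hΞ.add_posSemidef (le_iff.1 hΞS)
    rwa [add_sub_cancel] at this
  refine (iInf₂_le_of_le S F (iInf_le_of_le ⟨?_, hS0⟩ le_rfl)).trans ?_
  · rw [EReal.coe_le_coe_iff]
    exact (trace_mul_mono_left hΛ hS0.posSemidef.nonneg).trans hle
  · simpa only [lyap_apply, transpose_transpose] using hS

/-- A stabilizing gain yields a supersolution of the augmented Lyapunov equation. -/
theorem exists_supersolution {Ω : Type*} [MeasurableSpace Ω] {P : Measure Ω}
    [IsProbabilityMeasure P] {w : ℕ → Ω → ℝ} (hw : IsNoise P w) (h : Stabilizable P w A B C D)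
    {W : Matrix (Fin n ⊕ Fin m) (Fin n ⊕ Fin m) ℝ} (hW : 0 ≤ W) :
    ∃ F Y, W ≤ Y ∧ lyap (augmented A B F) (augmented C D F) Y + W ≤ Y := by
  obtain ⟨F, hF⟩ := h
  obtain ⟨N, hN⟩ := exists_iterate_lyap_le hw hF
  have hW' : 0 ≤ gainCost F W := by simpa [gainCost] using gainCost_mono F hW
  obtain ⟨Y, hY0, hY⟩ := exists_lyap_add_le hN hW'
  -- This lifts the state-space supersolution Y: applying `gainCost F` to the lift gives the
  -- closed-loop image of Y plus `gainCost F W`, which is at most Y.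
  refine ⟨F, lyap (fromCols A B) (fromCols C D) Y + W,
    le_add_of_nonneg_left (lyap_nonneg _ _ hY0), ?_⟩
  rw [lyap_augmented, gainCost_add, gainCost_lyap]
  exact add_le_add_left (lyap_mono _ _ hY) W

/-- Between a positive definite weight and a supersolution there is a solution of the Riccati
equation: the largest (in trace) subsolution. -/
theorem exists_riccati_solution {W Y : Matrix (Fin n ⊕ Fin m) (Fin n ⊕ Fin m) ℝ}
    {F₀ : Matrix (Fin m) (Fin n) ℝ} (hW : W.PosDef) (hWY : W ≤ Y)
    (hY : lyap (augmented A B F₀) (augmented C D F₀) Y + W ≤ Y) :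
    ∃ X, W ≤ X ∧ X ≤ Y ∧ (∀ F, X ≤ lyap (augmented A B F) (augmented C D F) X + W) ∧
      ∃ F, lyap (augmented A B F) (augmented C D F) X + W = X := by
  have hW0 : 0 ≤ W := hW.posSemidef.nonneg
  let K : Set (Matrix (Fin n ⊕ Fin m) (Fin n ⊕ Fin m) ℝ) :=
    ({X | W ≤ X} ∩ {X | X ≤ Y}) ∩ ⋂ F, {X | X ≤ lyap (augmented A B F) (augmented C D F) X + W}
  have hK : IsClosed K :=
    ((isClosed_setOf_le continuous_const continuous_id).inter
      (isClosed_setOf_le continuous_id continuous_const)).inter <| isClosed_iInter fun F =>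
        isClosed_setOf_le continuous_id ((continuous_lyap _ _).add continuous_const)
  have hKc : IsCompact K := isCompact_of_trace_le hK (fun X hX => hW0.trans hX.1.1)
    fun X hX => trace_mono hX.1.2
  -- The Riccati map, with F minimizing for X, preserves K: comparison with F₀ keeps it below Y, and
  -- monotonicity keeps it a subsolution for every gain.
  have hT : ∀ X ∈ K, ∃ X' ∈ K, X ≤ X' ∧
      ∃ F, lyap (augmented A B F) (augmented C D F) X + W = X' := by
    intro X hX
    have hsub : ∀ F, X ≤ lyap (augmented A B F) (augmented C D F) X + W := Set.mem_iInter.1 hX.2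
    have hXp : X.PosDef := by
      have := hW.add_posSemidef (le_iff.1 hX.1.1)
      rwa [add_sub_cancel] at this
    obtain ⟨F, hF⟩ := exists_gainCost_le hXp
    have hmin : ∀ F', lyap (augmented A B F) (augmented C D F) X + W ≤
        lyap (augmented A B F') (augmented C D F') X + W := fun F' => by
      rw [lyap_augmented, lyap_augmented]
      exact add_le_add_left (lyap_mono _ _ (hF F')) W
    refine ⟨lyap (augmented A B F) (augmented C D F) X + W, ⟨⟨?_, ?_⟩, Set.mem_iInter.2 fun F' => ?_⟩,
      hsub F, F, rfl⟩
    · exact le_add_of_nonneg_left (lyap_nonneg _ _ (hW0.trans hX.1.1))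
    · exact (hmin F₀).trans ((add_le_add_left (lyap_mono _ _ hX.1.2) W).trans hY)
    · exact (hmin F').trans (add_le_add_left (lyap_mono _ _ (hsub F)) W)
  obtain ⟨X, hX, F, hF⟩ := exists_fixed_of_isCompact hKc
    ⟨W, ⟨le_refl W, hWY⟩, Set.mem_iInter.2 fun F => le_add_of_nonneg_left (lyap_nonneg _ _ hW0)⟩ hT
  exact ⟨X, hX.1.1, hX.1.2, Set.mem_iInter.1 hX.2, F, hF⟩

/-- Strong duality from a supersolution `Y`. The weights `Λ + ε` give Riccati solutions whose gains
are primal feasible; a limit point of these solutions as `ε → 0` is dual feasible. No observability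
or detectability is needed, since every perturbed weight is positive definite. -/
theorem primalValue_eq_dualValue {Y : Matrix (Fin n ⊕ Fin m) (Fin n ⊕ Fin m) ℝ}
    {F₀ : Matrix (Fin m) (Fin n) ℝ} (hΛ : 0 ≤ Λ) (hΞ : Ξ.PosDef) (hΛY : Λ + 1 ≤ Y)
    (hY : lyap (augmented A B F₀) (augmented C D F₀) Y + (Λ + 1) ≤ Y) :
    primalValue A B C D Λ Ξ = dualValue A B C D Λ Ξ := by
  refine le_antisymm ?_ (dualValue_le_primalValue A C B D Λ Ξ)
  let ε : ℕ → ℝ := fun k => 1 / ((k : ℝ) + 1)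
  have hε : ∀ k, 0 < ε k := fun k => Nat.one_div_pos_of_nat
  -- As ε ≤ 1, the single Y bounds all the perturbed solutions, which gives compactness.
  have hε1 : ∀ k, Λ + ε k • 1 ≤ Λ + 1 := fun k => by
    have : ε k ≤ 1 := by
      simpa [ε] using one_div_le_one_div_of_le one_pos (show (1 : ℝ) ≤ k + 1 by simp)
    simpa using add_le_add_right (smul_one_mono this) Λ
  have hsol := fun k => exists_riccati_solution (W := Λ + ε k • 1)
    (PosDef.posSemidef_add (nonneg_iff_posSemidef.1 hΛ) (PosDef.one.smul (hε k)))
    ((hε1 k).trans hΛY) ((add_le_add_right (hε1 k) _).trans hY)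
  choose X hWX hXY hsub F hF using hsol
  have hX0 : ∀ k, 0 ≤ X k := fun k => by
    refine le_trans ?_ (hWX k)
    exact add_nonneg hΛ (nonneg_iff_posSemidef.2 (PosSemidef.one.smul (hε k).le))
  have hprimal : ∀ k, primalValue A B C D Λ Ξ ≤ ((trace (X k * Ξ) : ℝ) : EReal) := fun k =>
    primalValue_le_trace (hε k) hΞ (hX0 k) (le_add_of_nonneg_left hΛ)
      (le_add_of_nonneg_right (nonneg_iff_posSemidef.2 (PosSemidef.one.smul (hε k).le))) (hF k)
  have hKc : IsCompact {X : Matrix (Fin n ⊕ Fin m) (Fin n ⊕ Fin m) ℝ | 0 ≤ X ∧ X ≤ Y} :=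
    isCompact_of_trace_le (c := trace Y)
      (isClosed_setOf_nonneg.inter (isClosed_setOf_le continuous_id continuous_const))
      (fun X hX => hX.1) fun X hX => trace_mono hX.2
  have : FirstCountableTopology (Matrix (Fin n ⊕ Fin m) (Fin n ⊕ Fin m) ℝ) :=
    inferInstanceAs (FirstCountableTopology ((Fin n ⊕ Fin m) → (Fin n ⊕ Fin m) → ℝ))
  obtain ⟨Z, hZ, φ, hφ, hlim⟩ := hKc.tendsto_subseq fun k => ⟨hX0 k, hXY k⟩
  have hεlim : Tendsto (fun k => ε (φ k)) atTop (𝓝 0) :=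
    tendsto_one_div_add_atTop_nhds_zero_nat.comp hφ.tendsto_atTop
  have hdual : ∀ F, Z ≤ lyap (augmented A B F) (augmented C D F) Z + Λ := fun F => by
    rw [← sub_nonneg]
    have ht : Tendsto (fun k => lyap (augmented A B F) (augmented C D F) (X (φ k)) +
        (Λ + ε (φ k) • 1) - X (φ k)) atTop
        (𝓝 (lyap (augmented A B F) (augmented C D F) Z + (Λ + (0 : ℝ) • 1) - Z)) :=
      ((((continuous_lyap _ _).tendsto Z).comp hlim).add
        (tendsto_const_nhds.add (hεlim.smul_const 1))).sub hlim
    rw [zero_smul, add_zero] at ht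
    exact isClosed_setOf_nonneg.mem_of_tendsto ht
      (Eventually.of_forall fun k => sub_nonneg.2 (hsub (φ k) F))
  refine le_trans ?_ (trace_le_dualValue hZ.1 hdual)
  have ht : Tendsto (fun k => ((trace (X (φ k) * Ξ) : ℝ) : EReal)) atTop
      (𝓝 ((trace (Z * Ξ) : ℝ) : EReal)) := by
    have hc : Continuous fun X : Matrix (Fin n ⊕ Fin m) (Fin n ⊕ Fin m) ℝ =>
        ((trace (X * Ξ) : ℝ) : EReal) :=
      continuous_coe_real_ereal.comp (continuous_id.matrix_mul continuous_const).matrix_trace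
    exact (hc.tendsto Z).comp hlim
  exact ge_of_tendsto ht (Eventually.of_forall fun k => hprimal (φ k))

theorem weight_nonneg {Q : Matrix (Fin n) (Fin n) ℝ} {R : Matrix (Fin m) (Fin m) ℝ}
    (hQ : Q.PosSemidef) (hR : R.PosSemidef) : 0 ≤ weight Q R := by
  have h1 := transpose_mul_mul_same_mono hQ.nonneg
    (fromCols (1 : Matrix (Fin n) (Fin n) ℝ) (0 : Matrix (Fin n) (Fin m) ℝ))
  have h2 := transpose_mul_mul_same_mono hR.nonneg
    (fromCols (0 : Matrix (Fin m) (Fin n) ℝ) (1 : Matrix (Fin m) (Fin m) ℝ))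
  have h := add_le_add h1 h2
  simp only [Matrix.mul_zero, Matrix.zero_mul, add_zero] at h
  convert h using 1
  ext (i | i) (j | j) <;> simp [weight, transpose_fromCols, fromRows_mul, mul_fromCols]

end Duality

end SLQR

theorem mainTheorem7 {Ω : Type*} [MeasurableSpace Ω] (P : Measure Ω) [IsProbabilityMeasure P]
    (w : ℕ → Ω → ℝ) (hw : SLQR.IsNoise P w)
    (n m r : ℕ)
    (A : Matrix (Fin n) (Fin n) ℝ) (B : Matrix (Fin n) (Fin m) ℝ)
    (C : Matrix (Fin n) (Fin n) ℝ) (D : Matrix (Fin n) (Fin m) ℝ)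
    (Q : Matrix (Fin n) (Fin n) ℝ) (R : Matrix (Fin m) (Fin m) ℝ)
    (hQ : Q.PosSemidef) (hR : R.PosDef)
    (hstab : SLQR.Stabilizable P w A B C D)
    (hobs : SLQR.ExactlyObservable P w A C Q ∨ SLQR.ExactlyDetectable P w A C Q)
    (z : Fin r → Fin n → ℝ) (u₀ : Fin r → Fin m → ℝ)
    (hΞ : (SLQR.initialGram z u₀).PosDef) :
    SLQR.primalValue A B C D (SLQR.weight Q R) (SLQR.initialGram z u₀) =
      SLQR.dualValue A B C D (SLQR.weight Q R) (SLQR.initialGram z u₀) := by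
  open scoped MatrixOrder in
  have hΛ : 0 ≤ SLQR.weight Q R := SLQR.weight_nonneg hQ hR.posSemidef
  obtain ⟨F, Y, hΛY, hY⟩ := SLQR.exists_supersolution hw hstab
    (add_nonneg hΛ (nonneg_iff_posSemidef.2 PosSemidef.one))
  exact SLQR.primalValue_eq_dualValue hΛ hΞ hΛY hY
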